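/- Let $k$ be an algebraically closed field of characteristic $0$ and let $H$ be a finite-dimensional Hopf algebra over $k$ with antipode $S$. Equip $H^*$ with the convolution product $(\beta\gamma)(x)=\sum \beta(x_{(1)})\gamma(x_{(2)})$, and let $\lambda\in H^*$ be a non-zero right integral, i.e. $\lambda\beta=\beta(1)\lambda$ for all $\beta\in H^*$. Let $g\in H$ be the distinguished group-like element of $H$, i.e. the group-like element such that $\beta\lambda=\beta(g)\lambda$ for all $\beta\in H^*$. The index of $H$ is the least positive integer $n$ such that $S^{4n}=\mathrm{id}_H$ and $g^n=1$. Suppose that the index $n$ of $H$ is odd and $n>1$. Then the subspace $H_-=\{u\in H : S^{2n}(u)=-u\}$ of $H$ has even dimension. -/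

import Mathlib

open HopfAlgebra WithConv

namespace FinDimHopf

variable (k : Type*) {H : Type*} [Field k] [Ring H] [HopfAlgebra k H]

/-- A right integral of the dual algebra `H^*`, whose product is the convolution product
`(f * h)(x) = ∑ f(x₁) h(x₂)`: a functional `lam` with `lam * β = β(1) lam` for all `β` in `H^*`. -/
def IsRightIntegralDual (lam : WithConv (H →ₗ[k] k)) : Prop :=
  ∀ β : WithConv (H →ₗ[k] k), lam * β = β 1 • lam

/-- `g` is the distinguished group-like element of `H`: it is group-like, and `β * lam = β(g) lam`
for all `β` in `H^*`, where `lam` is a non-zero right integral of `H^*`. (Such a `lam` is unique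
up to a scalar when `H` is finite-dimensional, so the choice of `lam` does not matter.) -/
def IsDistinguishedGroupLike (g : H) : Prop :=
  IsGroupLikeElem k g ∧ ∃ lam : WithConv (H →ₗ[k] k), lam ≠ 0 ∧ IsRightIntegralDual k lam ∧
    ∀ β : WithConv (H →ₗ[k] k), β * lam = β g • lam

variable (H)

/-- `n` is the index of `H`: the least positive integer with `S^{4n} = id` and `g^n = 1`, where `S`
is the antipode and `g` the distinguished group-like element of `H`. Powers of `S` are taken with
respect to composition. -/
def HasIndex (n : ℕ) : Prop :=
  ∃ g : H, IsDistinguishedGroupLike k g ∧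
    IsLeast {m : ℕ | 0 < m ∧ (antipode k : Module.End k H) ^ (4 * m) = LinearMap.id ∧ g ^ m = 1} n

/-- The subspace `H_- = {u | S^{2n}(u) = -u}` of `H`. -/
def hMinus (n : ℕ) : Submodule k H where
  carrier := {u : H | ((antipode k : Module.End k H) ^ (2 * n)) u = -u}
  add_mem' := by
    intro a b ha hb
    simp only [Set.mem_ofPred_eq] at ha hb ⊢
    rw [map_add, ha, hb, neg_add]
  zero_mem' := by simp
  smul_mem' := by
    intro c a ha
    simp only [Set.mem_ofPred_eq] at ha ⊢
    rw [map_smul, ha, smul_neg]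

end FinDimHopf

open Coalgebra TensorProduct

namespace FinDimHopf

variable {k H : Type*} [Field k] [Ring H] [HopfAlgebra k H]

/-! Let `mu` be the integral and `B(u, v) = mu(u S(v))`. Nondegeneracy of `mu(xy)`
(`IsRightIntegral.eq_zero_of_forall_mul`) and uniqueness of integrals give `mu(S x) = mu(g x)`
(`antipode_eq_of_contractRight`) and `mu(g x g⁻¹) = c mu(x)` (`exists_conj_eq`), hence `mu(S² x) = c
mu(x)`. With `T = S²` and `L` left multiplication by `g`, this says `B(T v, u) = B(L u, v)`, and
both `T` and `L` scale `B` by `c`, where `c ^ n = 1`. For `n = 2m + 1`, twisting `B` by `(T L) ^ m`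
makes it skew and nondegenerate on the `-1`-eigenspace of `T ^ n`, which is `H_-`; so its dimension
is even (`even_finrank_of_twisted_symm`). -/

/-- Contraction of the left tensor factor with a functional. -/
noncomputable def contractLeft (mu : H →ₗ[k] k) : H ⊗[k] H →ₗ[k] H :=
  (TensorProduct.lid k H).toLinearMap ∘ₗ mu.rTensor H

/-- Contraction of the right tensor factor with a functional. -/
noncomputable def contractRight (mu : H →ₗ[k] k) : H ⊗[k] H →ₗ[k] H :=
  (TensorProduct.rid k H).toLinearMap ∘ₗ mu.lTensor H

@[simp]
lemma contractLeft_tmul (mu : H →ₗ[k] k) (a b : H) : contractLeft mu (a ⊗ₜ b) = mu a • b := by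
  simp [contractLeft]

@[simp]
lemma contractRight_tmul (mu : H →ₗ[k] k) (a b : H) : contractRight mu (a ⊗ₜ b) = mu b • a := by
  simp [contractRight]

/-- `mu(x₁) x₂ = mu(x) 1`. -/
def IsRightIntegral (mu : H →ₗ[k] k) : Prop := ∀ x, contractLeft mu (comul x) = mu x • 1

/-- `x₁ mu(x₂) = mu(x) 1`. -/
def IsLeftIntegral (mu : H →ₗ[k] k) : Prop := ∀ x, contractRight mu (comul x) = mu x • 1

lemma IsRightIntegralDual.isRightIntegral {lam : WithConv (H →ₗ[k] k)}
    (h : IsRightIntegralDual k lam) : IsRightIntegral lam.ofConv := by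
  intro x
  rw [← sub_eq_zero, ← Module.forall_dual_apply_eq_zero_iff k]
  intro f
  have h1 := congr($(h (toConv f)) x)
  rw [(ℛ k x).convMul_apply] at h1
  rw [← (ℛ k x).eq]
  simp only [map_sub, map_sum, contractLeft_tmul, map_smul, smul_eq_mul]
  rw [h1]
  simp [mul_comm]

lemma contractRight_comul_of_dual {lam : WithConv (H →ₗ[k] k)} {g : H}
    (h : ∀ β : WithConv (H →ₗ[k] k), β * lam = β g • lam) (x : H) :
    contractRight lam.ofConv (comul x) = lam x • g := by
  rw [← sub_eq_zero, ← Module.forall_dual_apply_eq_zero_iff k]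
  intro f
  have h1 := congr($(h (toConv f)) x)
  rw [(ℛ k x).convMul_apply] at h1
  rw [← (ℛ k x).eq]
  simp only [map_sub, map_sum, contractRight_tmul, map_smul, smul_eq_mul]
  simp only [mul_comm (lam _)] at h1 ⊢
  rw [h1]
  simp

/-! ### Convolution identities for the antipode, and their action on integrals. -/

lemma toConv_comul_antipode :
    (toConv (comul ∘ₗ antipode k) * toConv comul : WithConv (H →ₗ[k] H ⊗[k] H)) = 1 := by
  have h := congr((Bialgebra.comulAlgHom k H).toLinearMap ∘ₗ
    ($(LinearMap.antipode_mul_id (R := k) (C := H))).ofConv)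
  rw [LinearMap.algHom_comp_convMul_distrib] at h
  apply WithConv.ext
  refine Eq.trans ?_ (h.trans ?_)
  · rfl
  · ext x; simp [LinearMap.convOne_def]

lemma toConv_algHom_mul_antipode (f : H →ₐ[k] H ⊗[k] H) :
    (toConv f.toLinearMap * toConv (f.toLinearMap ∘ₗ antipode k) :
      WithConv (H →ₗ[k] H ⊗[k] H)) = 1 := by
  have h := congr(f.toLinearMap ∘ₗ ($(LinearMap.id_mul_antipode (R := k) (C := H))).ofConv)
  rw [LinearMap.algHom_comp_convMul_distrib] at h
  apply WithConv.ext
  refine Eq.trans ?_ (h.trans ?_)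
  · rfl
  · ext x; simp [LinearMap.convOne_def]

lemma toConv_antipode_mul_algHom (f : H →ₐ[k] H ⊗[k] H) :
    (toConv (f.toLinearMap ∘ₗ antipode k) * toConv f.toLinearMap :
      WithConv (H →ₗ[k] H ⊗[k] H)) = 1 := by
  have h := congr(f.toLinearMap ∘ₗ ($(LinearMap.antipode_mul_id (R := k) (C := H))).ofConv)
  rw [LinearMap.algHom_comp_convMul_distrib] at h
  apply WithConv.ext
  refine Eq.trans ?_ (h.trans ?_)
  · rfl
  · ext x; simp [LinearMap.convOne_def]

variable (k H) in
lemma toConv_includeLeft_mul_includeRight :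
    (toConv (Algebra.TensorProduct.includeLeft : H →ₐ[k] H ⊗[k] H).toLinearMap *
      toConv (Algebra.TensorProduct.includeRight : H →ₐ[k] H ⊗[k] H).toLinearMap :
      WithConv (H →ₗ[k] H ⊗[k] H)) = toConv comul := by
  ext x
  rw [(ℛ k x).convMul_apply]
  simp [(ℛ k x).eq]

lemma mul_eq_of_mul_eq_one_left {M : Type*} [Monoid M] {a b c d e : M} (h1 : b * c = 1)
    (h2 : c * a = d) (h3 : d * e = 1) : a * e = b := by
  rw [← one_mul a, ← h1, mul_assoc b, h2, mul_assoc, h3, mul_one]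

lemma mul_eq_of_mul_eq_one_right {M : Type*} [Monoid M] {a b c d e : M} (h1 : a * b = 1)
    (h2 : c * a = d) (h3 : e * d = 1) : e * c = b := by
  rw [← mul_one c, ← h1, ← mul_assoc c, h2, ← mul_assoc, h3, one_mul]

/-- `(1 ⊗ x₁) Δ(S x₂) = S x ⊗ 1`. -/
lemma includeRight_mul_comul_antipode :
    (toConv (Algebra.TensorProduct.includeRight : H →ₐ[k] H ⊗[k] H).toLinearMap *
      toConv (comul ∘ₗ antipode k) : WithConv (H →ₗ[k] H ⊗[k] H)) =
    toConv ((Algebra.TensorProduct.includeLeft : H →ₐ[k] H ⊗[k] H).toLinearMap ∘ₗ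
      antipode k) := by
  have h1 := toConv_antipode_mul_algHom (Algebra.TensorProduct.includeLeft : H →ₐ[k] H ⊗[k] H)
  have h2 := toConv_includeLeft_mul_includeRight k H
  have h3 := LinearMap.comul_right_inv (R := k) (C := H)
  exact mul_eq_of_mul_eq_one_left h1 h2 h3

/-- `Δ(S x₁) (x₂ ⊗ 1) = 1 ⊗ S x`. -/
lemma comul_antipode_mul_includeLeft :
    (toConv (comul ∘ₗ antipode k) *
      toConv (Algebra.TensorProduct.includeLeft : H →ₐ[k] H ⊗[k] H).toLinearMap :
      WithConv (H →ₗ[k] H ⊗[k] H)) =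
    toConv ((Algebra.TensorProduct.includeRight : H →ₐ[k] H ⊗[k] H).toLinearMap ∘ₗ
      antipode k) := by
  have h1 := toConv_algHom_mul_antipode (Algebra.TensorProduct.includeRight : H →ₐ[k] H ⊗[k] H)
  have h2 := toConv_includeLeft_mul_includeRight k H
  have h3 := toConv_comul_antipode (k := k) (H := H)
  exact mul_eq_of_mul_eq_one_right h1 h2 h3

lemma contractLeft_one_tmul_mul (mu : H →ₗ[k] k) (a : H) (t : H ⊗[k] H) :
    contractLeft mu ((1 ⊗ₜ a) * t) = a * contractLeft mu t := by
  induction t with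
  | zero => simp
  | tmul p q => simp
  | add p q hp hq => simp [mul_add, hp, hq]

lemma contractRight_mul_tmul_one (mu : H →ₗ[k] k) (a : H) (t : H ⊗[k] H) :
    contractRight mu (t * (a ⊗ₜ 1)) = contractRight mu t * a := by
  induction t with
  | zero => simp
  | tmul p q => simp
  | add p q hp hq => simp [add_mul, hp, hq]

lemma contractLeft_mul_tmul (mu : H →ₗ[k] k) (a b c d : H) (t : H ⊗[k] H) :
    contractLeft mu ((a ⊗ₜ b) * t * (c ⊗ₜ d)) =
      b * contractLeft (mu ∘ₗ LinearMap.mulLeft k a ∘ₗ LinearMap.mulRight k c) t * d := by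
  induction t with
  | zero => simp
  | tmul p q => simp [mul_assoc]
  | add p q hp hq => simp [mul_add, add_mul, hp, hq]

lemma contractRight_tmul_mul (mu : H →ₗ[k] k) (a b : H) (t : H ⊗[k] H) :
    contractRight mu ((a ⊗ₜ b) * t) =
      a * contractRight (mu ∘ₗ LinearMap.mulLeft k b) t := by
  induction t with
  | zero => simp
  | tmul p q => simp
  | add p q hp hq => simp [mul_add, hp, hq]

lemma IsRightIntegral.comp_antipode {mu : H →ₗ[k] k} (h : IsRightIntegral mu) :
    IsLeftIntegral (mu ∘ₗ antipode k) := by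
  intro x
  have h1 := congr(contractLeft mu ($(includeRight_mul_comul_antipode (k := k) (H := H)) x))
  rw [(ℛ k x).convMul_apply] at h1
  rw [← (ℛ k x).eq]
  simpa [contractLeft_one_tmul_mul, h _] using h1

lemma IsLeftIntegral.comp_antipode {mu : H →ₗ[k] k} (h : IsLeftIntegral mu) :
    IsRightIntegral (mu ∘ₗ antipode k) := by
  intro x
  have h1 := congr(contractRight mu ($(comul_antipode_mul_includeLeft (k := k) (H := H)) x))
  rw [(ℛ k x).convMul_apply] at h1
  rw [← (ℛ k x).eq]
  simpa [contractRight_mul_tmul_one, h _] using h1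

/-! ### Nondegeneracy of the integral. -/

/-- `mu(x₁ y) x₂ = mu(x y₁) S(y₂)` for a right integral `mu`. -/
lemma IsRightIntegral.contractLeft_comul_mul {mu : H →ₗ[k] k} (h : IsRightIntegral mu) (x y : H) :
    contractLeft (mu ∘ₗ LinearMap.mulRight k y) (comul x) =
      antipode k (contractLeft (mu ∘ₗ LinearMap.mulLeft k x) (comul y)) := by
  set P : WithConv (H →ₗ[k] H) := toConv
    (∑ i ∈ (ℛ k x).index, (mu ∘ₗ LinearMap.mulLeft k ((ℛ k x).left i)).smulRight ((ℛ k x).right i))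
    with hP
  set Q : WithConv (H →ₗ[k] H) := toConv ((mu ∘ₗ LinearMap.mulLeft k x).smulRight 1) with hQ
  -- The identity `mu(x₁ y₁) x₂ y₂ = mu(x y) 1`, read as a convolution in `y`; the factor `id` is
  -- then cancelled by its inverse `S`.
  have h1 : P * toConv LinearMap.id = Q := by
    ext y
    have h2 := h (x * y)
    rw [Bialgebra.comul_mul, ← (ℛ k x).eq, ← (ℛ k y).eq, Finset.sum_mul_sum, Finset.sum_comm] at h2
    rw [(ℛ k y).convMul_apply]
    simpa [hP, hQ, Finset.sum_mul] using h2
  have h3 : P = Q * toConv (antipode k) := by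
    rw [← h1, mul_assoc, LinearMap.id_mul_antipode, mul_one]
  have h4 := congr($h3 y)
  rw [(ℛ k y).convMul_apply] at h4
  rw [← (ℛ k x).eq, ← (ℛ k y).eq]
  simpa [hP, hQ] using h4

/-- The hypothesis `ht` puts `t` in `N ⊗ H`, with `N` the common kernel of `F`: expand `t` along a
basis of the right factor. -/
lemma eq_zero_of_contractLeft [FiniteDimensional k H] {M : Type*} [AddCommGroup M] [Module k M]
    (F : Set (H →ₗ[k] k)) (t : H ⊗[k] H) (ht : ∀ f ∈ F, contractLeft f t = 0)
    (Φ : H →ₗ[k] H →ₗ[k] M) (hΦ : ∀ a, (∀ f ∈ F, f a = 0) → Φ a = 0) :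
    TensorProduct.lift Φ t = 0 := by
  obtain ⟨b, rfl⟩ := TensorProduct.eq_repr_basis_right (Module.finBasis k H) t
  have hb : ∀ i, ∀ f ∈ F, f (b i) = 0 := by
    intro i f hf
    have h1 := ht f hf
    have h2 := (Module.finBasis k H).linearIndependent
    rw [Finsupp.sum_fintype _ _ (by simp)] at h1
    exact Fintype.linearIndependent_iff.mp h2 (fun i ↦ f (b i)) (by simpa using h1) i
  simp only [Finsupp.sum, map_sum, TensorProduct.lift.tmul]
  exact Finset.sum_eq_zero fun i _ ↦ by rw [hΦ _ (hb i)]; rfl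

/-- Let `N` be the left radical of `mu(xy)`. The exchange formula `contractLeft_comul_mul` gives
`Δ(N) ⊆ N ⊗ H`. Then `ε(x) mu(z) = mu(x₁ S(x₂) z) = 0` on `N`, so `ε` kills `N`, and `x = ε(x₁) x₂ =
0`. -/
lemma IsRightIntegral.eq_zero_of_forall_mul [FiniteDimensional k H] {mu : H →ₗ[k] k}
    (h : IsRightIntegral mu) (hmu : mu ≠ 0) {x : H} (hx : ∀ y, mu (x * y) = 0) : x = 0 := by
  set F : Set (H →ₗ[k] k) := Set.range fun y ↦ mu ∘ₗ LinearMap.mulRight k y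
  have hF : ∀ a, (∀ f ∈ F, f a = 0) → ∀ y, mu (a * y) = 0 := by
    intro a ha y
    simpa using ha _ ⟨y, rfl⟩
  have h1 : ∀ x : H, (∀ y, mu (x * y) = 0) → ∀ f ∈ F, contractLeft f (comul x) = 0 := by
    rintro x hx _ ⟨y, rfl⟩
    simp only
    rw [h.contractLeft_comul_mul, show mu ∘ₗ LinearMap.mulLeft k x = 0 by ext; simp [hx]]
    simp [contractLeft]
  have h2 : ∀ x : H, (∀ y, mu (x * y) = 0) → counit (R := k) x = 0 := by
    intro x hx
    obtain ⟨z, hz⟩ := DFunLike.ne_iff.mp hmu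
    have h3 := eq_zero_of_contractLeft F (comul x) (h1 x hx)
      (((LinearMap.mul k H).compr₂ (mu ∘ₗ LinearMap.mulRight k z)).compl₂ (antipode k))
      (fun a ha ↦ by ext b; simpa [mul_assoc] using hF a ha (antipode k b * z))
    have h4 := congr(mu ($(sum_mul_antipode_eq_smul (ℛ k x)) * z))
    rw [← (ℛ k x).eq] at h3
    simp only [map_sum, TensorProduct.lift.tmul] at h3
    simp only [Finset.sum_mul, map_sum] at h4
    have h5 : counit (R := k) x * mu z = 0 := by
      simpa using h4.symm.trans h3
    exact (mul_eq_zero.mp h5).resolve_right hz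
  have h3 := eq_zero_of_contractLeft F (comul x) (h1 x hx)
    (LinearMap.lsmul k H ∘ₗ counit) (fun a ha ↦ by
      ext; simp [h2 a (hF a ha)])
  rw [← (ℛ k x).eq] at h3
  rw [← sum_counit_smul (ℛ k x)]
  simpa using h3

lemma IsRightIntegral.sub_smul {mu nu : H →ₗ[k] k} (h : IsRightIntegral mu) (h' : IsRightIntegral nu)
    (a : k) : IsRightIntegral (nu - a • mu) := by
  intro x
  have h1 : contractLeft (nu - a • mu) = contractLeft nu - a • contractLeft mu := by
    ext; simp [_root_.sub_smul, mul_smul]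
  rw [h1]
  simp [h x, h' x, _root_.sub_smul, mul_smul]

/-- Apply `mu` to the exchange formula at `y = La`. The left side is `mu(La) mu(x)`; the right side
is `mu(x La₁) mu(S La₂) = mu(x) mu(S La)`, as `mu ∘ S` is a left integral. -/
lemma IsRightIntegral.antipode_integral {mu : H →ₗ[k] k} (h : IsRightIntegral mu) (hmu : mu ≠ 0) {La : H}
    (hLa : ∀ x, x * La = counit (R := k) x • La) : mu (antipode k La) = mu La := by
  obtain ⟨x, hx⟩ := DFunLike.ne_iff.mp hmu
  have h1 := congr(mu $(h.contractLeft_comul_mul x La))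
  have h2 := congr(mu (x * $(h.comp_antipode La)))
  rw [← (ℛ k x).eq, ← (ℛ k La).eq] at h1
  rw [← (ℛ k La).eq] at h2
  have h3 : mu (∑ i ∈ (ℛ k x).index, counit (R := k) ((ℛ k x).left i) • (ℛ k x).right i) = mu x := by
    rw [sum_counit_smul]
  simp only [map_sum, contractLeft_tmul, contractRight_tmul, LinearMap.comp_apply,
    LinearMap.mulRight_apply, LinearMap.mulLeft_apply, hLa, map_smul, smul_eq_mul,
    Finset.mul_sum, mul_smul_comm, mul_one] at h1 h2 h3
  refine mul_right_cancel₀ hx ?_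
  rw [← h2, ← h3, Finset.mul_sum]
  refine Eq.trans ?_ (h1.symm.trans ?_)
  · exact Finset.sum_congr rfl fun i _ ↦ mul_comm _ _
  · exact Finset.sum_congr rfl fun i _ ↦ by ring

/-! ### Integrals in `H` and uniqueness of integrals on `H`. -/

section FiniteDimensional

variable [FiniteDimensional k H] {mu : H →ₗ[k] k}

lemma IsRightIntegral.injective_mul (h : IsRightIntegral mu) (hmu : mu ≠ 0) :
    Function.Injective ((LinearMap.mul k H).compr₂ mu) := by
  rw [injective_iff_map_eq_zero]
  exact fun x hx ↦ h.eq_zero_of_forall_mul hmu fun y ↦ by simpa using congr($hx y)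

lemma IsRightIntegral.injective_mul_flip (h : IsRightIntegral mu) (hmu : mu ≠ 0) :
    Function.Injective ((LinearMap.mul k H).compr₂ mu).flip := by
  have h1 := (LinearMap.injective_iff_surjective_of_finrank_eq_finrank
    (Subspace.dual_finrank_eq (K := k) (V := H)).symm).mp (h.injective_mul hmu)
  rw [injective_iff_map_eq_zero]
  intro y hy
  rw [← Module.forall_dual_apply_eq_zero_iff k]
  intro f
  obtain ⟨x, rfl⟩ := h1 f
  simpa using congr($hy x)

lemma IsRightIntegral.exists_integral (h : IsRightIntegral mu) (hmu : mu ≠ 0) :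
    ∃ La : H, mu La = 1 ∧ ∀ x, x * La = counit (R := k) x • La := by
  have h1 := h.injective_mul_flip hmu
  have h2 := (LinearMap.injective_iff_surjective_of_finrank_eq_finrank
    (Subspace.dual_finrank_eq (K := k) (V := H)).symm).mp h1
  obtain ⟨La, hLa⟩ := h2 counit
  have h3 : ∀ x, mu (x * La) = counit (R := k) x := fun x ↦ by simpa using congr($hLa x)
  refine ⟨La, by simpa using h3 1, fun x ↦ h1 ?_⟩
  ext y
  simp [← mul_assoc, h3, mul_comm]

lemma IsRightIntegral.apply_integral_ne_zero (h : IsRightIntegral mu) (hmu : mu ≠ 0)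
    (hS : Function.Bijective (antipode k : H → H)) {La : H} (hLa0 : La ≠ 0)
    (hLa : ∀ x, x * La = counit (R := k) x • La) : mu La ≠ 0 := by
  intro h0
  rw [← h.antipode_integral hmu hLa] at h0
  refine hLa0 (hS.1 ?_)
  rw [map_zero]
  refine h.eq_zero_of_forall_mul hmu fun y ↦ ?_
  obtain ⟨z, rfl⟩ := hS.2 y
  rw [← antipode_mul_antidistrib, hLa]
  simp [h0]

/-- Normalize `mu(La) = 1`: the right integral `nu - nu(La) mu` vanishes at `La`, which no non-zero
right integral does. -/
lemma IsRightIntegral.exists_eq_smul {nu : H →ₗ[k] k} (h : IsRightIntegral mu) (hmu : mu ≠ 0)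
    (h' : IsRightIntegral nu) (hS : Function.Bijective (antipode k : H → H)) :
    ∃ a : k, nu = a • mu := by
  obtain ⟨La, h1, hLa⟩ := h.exists_integral hmu
  refine ⟨nu La, ?_⟩
  by_contra h2
  refine (h.sub_smul h' (nu La)).apply_integral_ne_zero (sub_ne_zero.mpr h2) hS ?_ hLa ?_
  · rintro rfl
    simp at h1
  · simp [h1]

/-! ### The distinguished group-like element. -/

section Distinguished

variable {g : H}

lemma antipode_eq_of_contractRight (hS : Function.Bijective (antipode k : H → H))
    (h : IsRightIntegral mu) (hmu : mu ≠ 0) (hg : IsGroupLikeElem k g)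
    (hd : ∀ x, contractRight mu (comul x) = mu x • g) (x : H) :
    mu (antipode k x) = mu (g * x) := by
  have h1 : IsLeftIntegral (mu ∘ₗ LinearMap.mulLeft k g) := by
    intro x
    have h2 := hd (g * x)
    rw [Bialgebra.comul_mul, hg.comul_eq_tmul_self, contractRight_tmul_mul] at h2
    have h3 := congr(antipode k g * $h2)
    simpa [← mul_assoc, hg.antipode_mul_cancel] using h3
  have h2 : mu ∘ₗ antipode k ∘ₗ antipode k ≠ 0 := by
    intro h0
    refine hmu (LinearMap.ext fun x ↦ ?_)
    obtain ⟨y, rfl⟩ := (hS.comp hS).2 x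
    exact congr($h0 y)
  -- Both `mu ∘ S²` and `mu(g S(·))` are right integrals, hence proportional; evaluating at `La`
  -- below shows that the factor is `1`.
  obtain ⟨a, ha⟩ := h.comp_antipode.comp_antipode.exists_eq_smul h2 h1.comp_antipode hS
  have h3 : ∀ x, mu (g * x) = a * mu (antipode k x) := by
    intro x
    obtain ⟨y, rfl⟩ := hS.2 x
    simpa using congr($ha y)
  obtain ⟨La, h4, hLa⟩ := h.exists_integral hmu
  have h5 := h3 La
  rw [hLa, hg.counit_eq_one, one_smul, h.antipode_integral hmu hLa, h4, mul_one] at h5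
  rw [h3, ← h5, one_mul]

lemma exists_conj_eq (hS : Function.Bijective (antipode k : H → H))
    (h : IsRightIntegral mu) (hmu : mu ≠ 0) (hg : IsGroupLikeElem k g) :
    ∃ c : k, ∀ x, mu (g * x * antipode k g) = c * mu x := by
  have h1 : IsRightIntegral (mu ∘ₗ LinearMap.mulLeft k g ∘ₗ LinearMap.mulRight k (antipode k g)) := by
    intro x
    have h2 := h (g * x * antipode k g)
    rw [Bialgebra.comul_mul, Bialgebra.comul_mul, hg.comul_eq_tmul_self,
      hg.antipode.comul_eq_tmul_self, contractLeft_mul_tmul] at h2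
    have h3 := congr(antipode k g * $h2 * g)
    rw [← mul_assoc, ← mul_assoc, hg.antipode_mul_cancel, one_mul, mul_assoc,
      hg.antipode_mul_cancel, mul_one] at h3
    simpa [mul_assoc, hg.antipode_mul_cancel] using h3
  obtain ⟨c, hc⟩ := h.exists_eq_smul hmu h1 hS
  exact ⟨c, fun x ↦ by simpa [mul_assoc] using congr($hc x)⟩

end Distinguished

end FiniteDimensional

end FinDimHopf

/-! ### Twisted symmetric forms. -/

section LinearAlgebra

variable {k V : Type*} [Field k] [CharZero k] [AddCommGroup V] [Module k V] [FiniteDimensional k V]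

/-- A space carrying a nondegenerate skew-symmetric form has even dimension. -/
lemma even_finrank_of_skew (B : V →ₗ[k] V →ₗ[k] k) (hskew : ∀ u v, B u v = -B v u)
    (hB : ∀ u, (∀ v, B u v = 0) → u = 0) : Even (Module.finrank k V) := by
  set b := Module.finBasis k V
  set A : Matrix (Fin (Module.finrank k V)) (Fin (Module.finrank k V)) k :=
    LinearMap.toMatrix₂ b b B with hA
  have hT : A.transpose = -A := by
    ext i j
    simp [hA, LinearMap.toMatrix₂_apply, hskew (b j) (b i)]
  have hdet : A.det ≠ 0 := by
    have h1 : B.SeparatingLeft := fun u hu ↦ hB u hu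
    exact (LinearMap.separatingLeft_iff_det_ne_zero b).mp h1
  by_contra hodd
  rw [Nat.not_even_iff_odd] at hodd
  have h1 := congr(Matrix.det $hT)
  rw [Matrix.det_transpose, Matrix.det_neg, Fintype.card_fin, hodd.neg_one_pow] at h1
  exact hdet (self_eq_neg.mp (by simpa using h1))

/-- A nondegenerate form which is symmetric up to the twist `B (T v) u = B (L u) v` by two
commuting similitudes with the same multiplier is, after a twist, skew-symmetric and nondegenerate
on the `-1`-eigenspace of `T ^ n`, provided that `n` is odd. -/
lemma even_finrank_of_twisted_symm (B : V →ₗ[k] V →ₗ[k] k) (hB : ∀ u, (∀ v, B u v = 0) → u = 0)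
    (T L : Module.End k V) (hTL : Commute T L) (hsymm : ∀ u v, B (T v) u = B (L u) v) (c : k)
    (hT : ∀ u v, B (T u) (T v) = c * B u v) (hL : ∀ u v, B (L u) (L v) = c * B u v)
    {n : ℕ} (hn : Odd n) (hTn : T ^ (2 * n) = 1) (hLn : L ^ n = 1) (hcn : c ^ n = 1)
    (W : Submodule k V) (hW : ∀ u, u ∈ W ↔ (T ^ n) u = -u) : Even (Module.finrank k W) := by
  obtain ⟨m, rfl⟩ := hn
  have hTpow : ∀ j u v, B ((T ^ j) u) ((T ^ j) v) = c ^ j * B u v := by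
    intro j
    induction j with
    | zero => simp
    | succ j ih => intro u v; simp [pow_succ', hT, ih, mul_assoc]
  have hLpow : ∀ j u v, B ((L ^ j) u) ((L ^ j) v) = c ^ j * B u v := by
    intro j
    induction j with
    | zero => simp
    | succ j ih => intro u v; simp [pow_succ', hL, ih, mul_assoc]
  -- `P` acts as a square root: `P L T P = (T L) ^ n = T ^ n`, which is `-1` on `W`; this is where
  -- `n` odd enters.
  set P : Module.End k V := T ^ m * L ^ m with hP
  have hPB : ∀ u v, B (P u) (P v) = c ^ (2 * m) * B u v := by
    intro u v
    simp only [hP, Module.End.mul_apply, hTpow, hLpow]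
    ring
  have hPP : P * (L * (T * P)) = T ^ (2 * m + 1) * L ^ (2 * m + 1) := by
    have e1 : P = (T * L) ^ m := by rw [hP, hTL.mul_pow]
    rw [← hTL.mul_pow, ← mul_assoc L, ← hTL.eq, e1, ← pow_succ', ← pow_add]
    congr 1
    ring
  have hTP : Commute (T ^ (2 * m + 1)) P :=
    ((Commute.refl T).pow_pow _ _).mul_right (hTL.pow_pow _ _)
  have hskew : ∀ u ∈ W, ∀ v ∈ W, B u (P v) = -B v (P u) := by
    intro u hu v _
    have h1 : c * B v (P u) = B (L (T (P u))) v := by rw [← hT, hsymm]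
    have h2 : c ^ (2 * m + 1) * B v (P u) = B ((P * (L * (T * P))) u) (P v) := by
      simp only [Module.End.mul_apply]
      rw [hPB, ← h1]
      ring
    rw [hPP, hLn, mul_one, (hW u).mp hu, hcn, one_mul] at h2
    rw [h2]
    simp
  have hPsurj : Function.Surjective P := by
    have hu : IsUnit P := ((IsUnit.of_pow_eq_one hTn (by omega)).pow m).mul
      ((IsUnit.of_pow_eq_one hLn (by omega)).pow m)
    exact ((Module.End.isUnit_iff P).mp hu).2
  refine even_finrank_of_skew (B.compl₁₂ W.subtype (P ∘ₗ W.subtype)) ?_ ?_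
  · intro u v
    exact hskew u u.2 v v.2
  · intro u hu
    refine Subtype.ext (hB _ fun y ↦ ?_)
    obtain ⟨y, rfl⟩ := hPsurj y
    have hTT : ∀ x, (T ^ (2 * m + 1)) ((T ^ (2 * m + 1)) x) = x := by
      intro x
      rw [← Module.End.mul_apply, ← pow_add, ← two_mul, hTn, Module.End.one_apply]
    have h1 : B u (P (y - (T ^ (2 * m + 1)) y)) = 0 :=
      hu ⟨y - (T ^ (2 * m + 1)) y, (hW _).mpr (by rw [map_sub, hTT, neg_sub])⟩
    -- `T ^ n` preserves `B` because `c ^ n = 1`, so its `-1`- and `+1`-eigenspaces are orthogonal.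
    have h2 : B u (P (y + (T ^ (2 * m + 1)) y)) = 0 := by
      have h3 := hTpow (2 * m + 1) u (P (y + (T ^ (2 * m + 1)) y))
      rw [← Module.End.mul_apply, hTP.eq, Module.End.mul_apply, map_add (T ^ (2 * m + 1)), hTT,
        (hW _).mp u.2, hcn, one_mul, add_comm, map_neg, LinearMap.neg_apply] at h3
      exact self_eq_neg.mp h3.symm
    have h3 : (2 : k) * B u (P y) = 0 := by
      simp only [map_sub, map_add] at h1 h2
      linear_combination h1 + h2
    simpa using h3

end LinearAlgebra

theorem corollary3p2 {k : Type*} [Field k] [IsAlgClosed k] [CharZero k]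
    {H : Type*} [Ring H] [HopfAlgebra k H] [FiniteDimensional k H]
    (n : ℕ) (hn : 1 < n) (hodd : Odd n) (hindex : FinDimHopf.HasIndex k H n) :
    Even (Module.finrank k (FinDimHopf.hMinus k H n)) := by
  obtain ⟨g, ⟨hg, lam, hlam0, hlam, hdist⟩, ⟨-, hSn, hgn⟩, -⟩ := hindex
  set mu : H →ₗ[k] k := lam.ofConv
  have hmu : mu ≠ 0 := fun h ↦ hlam0 (WithConv.ext h)
  have hint : FinDimHopf.IsRightIntegral mu := hlam.isRightIntegral
  set S : Module.End k H := antipode k with hS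
  have hSbij : Function.Bijective S := by
    have hu : IsUnit S := IsUnit.of_pow_eq_one (n := 4 * n) hSn (by omega)
    exact (Module.End.isUnit_iff S).mp hu
  have hSmul : ∀ a b, S (a * b) = S b * S a := antipode_mul_antidistrib
  have hmuS : ∀ x, mu (S x) = mu (g * x) :=
    FinDimHopf.antipode_eq_of_contractRight hSbij hint hmu hg
      (FinDimHopf.contractRight_comul_of_dual hdist)
  obtain ⟨c, hc⟩ := FinDimHopf.exists_conj_eq hSbij hint hmu hg
  have hSS : ∀ x, mu (S (S x)) = c * mu x := by
    intro x
    -- Both sides equal `mu(g S(x))`: `c mu(x) = mu(g x S(g)) = mu(S(x S(g)))` and `S² g = g`.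
    rw [hmuS, ← hc, mul_assoc g x, ← hmuS (x * _), ← hS, hSmul, hS, hg.antipode_antipode, ← hS]
  have hSg : (S g) ^ n = 1 := by
    have h1 : g ^ n * (S g) ^ n = 1 := by
      rw [← (show Commute g (S g) from hg.mul_antipode_cancel.trans
        hg.antipode_mul_cancel.symm).mul_pow, hS, hg.mul_antipode_cancel, one_pow]
    rwa [hgn, one_mul] at h1
  have hcpow : ∀ j x, mu (g ^ j * x * (S g) ^ j) = c ^ j * mu x := by
    intro j
    induction j with
    | zero => simp
    | succ j ih =>
      intro x
      rw [show g ^ (j + 1) * x * S g ^ (j + 1) = g * (g ^ j * x * S g ^ j) * S g by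
        rw [pow_succ', pow_succ]; simp only [mul_assoc], hc, ih]
      ring
  have hcn : c ^ n = 1 := by
    obtain ⟨x, hx⟩ := DFunLike.ne_iff.mp hmu
    have h1 := hcpow n x
    rw [hgn, hSg, one_mul, mul_one] at h1
    exact mul_right_cancel₀ hx (by rw [← h1, one_mul])
  have hLpow : ∀ j, (LinearMap.mulLeft k g) ^ j = LinearMap.mulLeft k (g ^ j) :=
    LinearMap.pow_mulLeft k H g
  refine even_finrank_of_twisted_symm (((LinearMap.mul k H).compr₂ mu).compl₂ S) ?_ (S ^ 2)
    (LinearMap.mulLeft k g) ?_ ?_ c ?_ ?_ hodd ?_ ?_ hcn _ ?_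
  · intro u hu
    refine hint.eq_zero_of_forall_mul hmu fun y ↦ ?_
    obtain ⟨y, rfl⟩ := hSbij.2 y
    simpa using hu y
  · ext x
    simp [pow_two, hS, antipode_mul_antidistrib, hg.antipode_antipode]
  · intro u v
    have h1 := hmuS (u * S v)
    rw [hSmul] at h1
    simpa [pow_two, mul_assoc] using h1
  · intro u v
    have h1 := hSS (u * S v)
    rw [hSmul, hSmul] at h1
    simpa [pow_two] using h1
  · intro u v
    simpa [hSmul, mul_assoc] using hc (u * S v)
  · rw [← pow_mul, ← mul_assoc]
    exact hSn
  · rw [hLpow, hgn, LinearMap.mulLeft_one]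
    rfl
  · intro u
    rw [← pow_mul]
    rfl
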